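/- **Setting.** There are finite sets $D$ of doctors, $H$ of hospitals and $R$ of regions; each hospital $h$ lies in exactly one region $r(h)$ and has a capacity $q_h\ge 1$, and each region $r$ has a regional cap $q_r\in\mathbb Z_{\ge 0}$. Each doctor $d$ has a strict preference (linear order) $\succ_d$ on $H\cup\{\varnothing\}$, and each hospital $h$ has a strict preference $\succ_h$ on the subsets of $D$ that is responsive with capacity $q_h$: for $D'\subseteq D$ with $|D'|\le q_h$, $d\in D\setminus D'$ and $d'\in D'$, one has $(D'\cup\{d\})\setminus\{d'\}\succeq_h D'$ iff $\{d\}\succeq_h\{d'\}$, and $D'\succeq_h D'\setminus\{d'\}$ iff $\{d'\}\succeq_h\varnothing$; and $\varnothing\succ_h D'$ whenever $|D'|>q_h$. We write $d\succ_h d'$ for $\{d\}\succ_h\{d'\}$; $d$ is acceptable to $h$ if $d\succ_h\varnothing$ (that is, $\{d\}\succ_h\varnothing$), and $h$ is acceptable to $d$ if $h\succ_d\varnothing$. A matching $\mu$ assigns to each doctor $d$ an element $\mu_d\in H\cup\{\varnothing\}$; let $\mu_h=\{d:\mu_d=h\}$. It is *feasible* if $|\mu_h|\le q_h$ for all $h$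 and $\sum_{h:\,r(h)=r}|\mu_h|\le q_r$ for all $r$. It is *constrained efficient* if it is feasible and no feasible matching $\mu'$ satisfies $\mu'_i\succeq_i\mu_i$ for all $i\in D\cup H$ and $\mu'_i\succ_i\mu_i$ for some $i\in D\cup H$. It is *individually rational* if no agent is matched with an unacceptable agent. A pair $(d,h)$ *blocks* $\mu$ if $h\succ_d\mu_d$ and either $|\mu_h|<q_h$ and $d\succ_h\varnothing$, or $d\succ_h d'$ for some $d'\in\mu_h$. The matching $\mu$ is *weakly stable* if it is feasible, individually rational, and for every blocking pair $(d,h)$ one has $\sum_{h':\,r(h')=r(h)}|\mu_{h'}|=q_{r(h)}$ and $d'\succ_h d$ for all $d'\in\mu_h$. An *allocation of the regional caps* is a vector of target capacities $(t_h)_{h\in H}$ of non-negative integers with $t_h\le q_h$ for all $h$ and $\sum_{h:\,r(h)=r}t_h\le q_r$ for all $r$. $\mathrm{DA}(t)$ denotes the matching produced by the doctor-proposing deferred acceptance algorithm in which each hospital $h$ has capacity $t_h$ in place of $q_h$. **Theorem 1.** Let $t$ be an allocation of the regional caps for which the matching $\mu=\mathrm{DA}(t)$ is not constrained efficient. Then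 there is an adapted allocation of the regional caps $\tilde t$, in the sense that $\tilde\mu=\mathrm{DA}(\tilde t)$ satisfies $|\tilde\mu_h|=\tilde t_h$ for every hospital $h$, such that $\tilde\mu$ is constrained efficient and weakly stable and $\tilde\mu_d\succeq_d\mu_d$ for every doctor $d$. -/

import Mathlib

/-! Matching with regional constraints: the market, matchings and their properties, and the
doctor-proposing deferred acceptance algorithm run with a profile of target capacities. -/

namespace RegionalMatching

noncomputable section

open scoped Classical

/-- The weak preference `a ⪰ b` that belongs to a strict preference `P` (`P a b` means `a ≻ b`). -/
def Weak {α : Type*} (P : α → α → Prop) (a b : α) : Prop := P a b ∨ a = b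

/-- A strict preference `P` over sets of doctors is responsive with capacity `q`.  A single doctor
`d` is compared as the set `{d}`, and being unmatched is the empty set. -/
structure Responsive {D : Type*} (P : Finset D → Finset D → Prop) (q : ℕ) : Prop where
  swap : ∀ S : Finset D, S.card ≤ q → ∀ d, d ∉ S → ∀ d', d' ∈ S →
    (Weak P ((insert d S).erase d') S ↔ Weak P {d} {d'})
  drop : ∀ S : Finset D, S.card ≤ q → ∀ d', d' ∈ S →
    (Weak P S (S.erase d') ↔ Weak P {d'} ∅)
  overfull : ∀ S : Finset D, q < S.card → P ∅ S

/-- A matching market with regional caps; `D`, `H`, `R` are the doctors, hospitals, regions.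
In `docPref`, `none` is the state of being unmatched; `docPref d a b` means `a ≻_d b`. -/
structure Market (D H R : Type*) where
  region : H → R
  regCap : R → ℕ
  cap : H → ℕ
  cap_pos : ∀ h, 0 < cap h
  docPref : D → Option H → Option H → Prop
  docPref_strict : ∀ d, IsStrictTotalOrder (Option H) (docPref d)
  hospPref : H → Finset D → Finset D → Prop
  hospPref_strict : ∀ h, IsStrictTotalOrder (Finset D) (hospPref h)
  responsive : ∀ h, Responsive (hospPref h) (cap h)

/-- A matching, given by the assignment `μ_d` of the doctors. -/
abbrev Matching (D H : Type*) := D → Option H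

/-- The set `μ_h` of doctors matched with hospital `h`. -/
def Matching.at {D H : Type*} [Fintype D] (μ : Matching D H) (h : H) : Finset D :=
  Finset.univ.filter fun d => μ d = some h

namespace Market

variable {D H R : Type*} [Fintype D] [Fintype H] (M : Market D H R)

/-- `d ≻_h d'` -/
def PrefersDoctor (h : H) (d d' : D) : Prop := M.hospPref h {d} {d'}

/-- Doctor `d` is acceptable to hospital `h`. -/
def AcceptableDoctor (h : H) (d : D) : Prop := M.hospPref h {d} ∅

/-- Hospital `h` is acceptable to doctor `d`. -/
def AcceptableHospital (d : D) (h : H) : Prop := M.docPref d (some h) none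

/-- The hospitals located in region `r`. -/
def hospitalsIn (r : R) : Finset H := Finset.univ.filter fun h => M.region h = r

/-- The number of doctors matched in region `r`. -/
def regionLoad (μ : Matching D H) (r : R) : ℕ := ∑ h ∈ M.hospitalsIn r, (μ.at h).card

/-- Feasibility: regional caps and physical capacities are respected. -/
def Feasible (μ : Matching D H) : Prop :=
  (∀ r, M.regionLoad μ r ≤ M.regCap r) ∧ ∀ h, (μ.at h).card ≤ M.cap h

/-- Constrained efficiency: feasible, and not Pareto dominated (with respect to all doctors and
all hospitals) by a feasible matching. -/
def ConstrainedEfficient (μ : Matching D H) : Prop :=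
  M.Feasible μ ∧
    ¬ ∃ μ' : Matching D H, M.Feasible μ' ∧
      (∀ d, Weak (M.docPref d) (μ' d) (μ d)) ∧
      (∀ h, Weak (M.hospPref h) (μ'.at h) (μ.at h)) ∧
      ((∃ d, M.docPref d (μ' d) (μ d)) ∨ ∃ h, M.hospPref h (μ'.at h) (μ.at h))

/-- No agent is matched with an unacceptable agent. -/
def IndividuallyRational (μ : Matching D H) : Prop :=
  ∀ d h, μ d = some h → M.AcceptableHospital d h ∧ M.AcceptableDoctor h d

/-- `(d, h)` is a blocking pair of `μ`. -/
def BlockingPair (μ : Matching D H) (d : D) (h : H) : Prop :=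
  M.docPref d (some h) (μ d) ∧
    (((μ.at h).card < M.cap h ∧ M.AcceptableDoctor h d) ∨ ∃ d' ∈ μ.at h, M.PrefersDoctor h d d')

/-- Weak stability. -/
def WeaklyStable (μ : Matching D H) : Prop :=
  M.Feasible μ ∧ M.IndividuallyRational μ ∧
    ∀ d h, M.BlockingPair μ d h →
      M.regionLoad μ (M.region h) = M.regCap (M.region h) ∧ ∀ d' ∈ μ.at h, M.PrefersDoctor h d' d

/-- `t` is an allocation of the regional caps: a profile of target capacities that respects the
physical capacities and, summed over each region, the regional cap. -/
def IsAllocation (t : H → ℕ) : Prop :=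
  (∀ h, t h ≤ M.cap h) ∧ ∀ r, ∑ h ∈ M.hospitalsIn r, t h ≤ M.regCap r

/-! ### The deferred acceptance algorithm

The state of the algorithm is the set `S` of all pairs `(d, h)` such that `h` has rejected `d`. -/

/-- `h` is the most preferred hospital of `d` among those that have not rejected her, and it is
acceptable to her. -/
def IsNextChoice (S : Finset (D × H)) (d : D) (h : H) : Prop :=
  (d, h) ∉ S ∧ M.AcceptableHospital d h ∧
    ∀ h', (d, h') ∉ S → Weak (M.docPref d) (some h) (some h')

/-- The hospital at which `d` is an applicant when the rejections `S` have been made: the one that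
keeps her tentatively, or, if she has just been rejected, the next one on her list.  It is `none`
if no acceptable hospital is left. -/
def application (S : Finset (D × H)) : Matching D H := fun d =>
  if hd : ∃ h, M.IsNextChoice S d h then some hd.choose else none

/-- Among the applicants `A`, hospital `h` with capacity `n` keeps `d`: she is acceptable, and
fewer than `n` applicants are ranked above her. -/
def Keeps (n : ℕ) (h : H) (A : Finset D) (d : D) : Prop :=
  d ∈ A ∧ M.AcceptableDoctor h d ∧ (A.filter fun d' => M.PrefersDoctor h d' d).card < n

/-- One step of deferred acceptance with capacities `t`: every hospital rejects those of its
current applicants that it does not keep. -/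
def daStep (t : H → ℕ) (S : Finset (D × H)) : Finset (D × H) :=
  S ∪ Finset.univ.filter fun p : D × H =>
    p.1 ∈ (M.application S).at p.2 ∧ ¬ M.Keeps (t p.2) p.2 ((M.application S).at p.2) p.1

/-- The rejections made in a run of deferred acceptance.  A step without a new rejection is
followed by no new application, so `|D| * |H|` steps reach the end (`daStep_finalRejections`). -/
def finalRejections (t : H → ℕ) : Finset (D × H) :=
  (M.daStep t)^[Fintype.card D * Fintype.card H] ∅

/-- The matching produced by the (doctor-proposing) deferred acceptance algorithm in which each
hospital `h` has capacity `t h`. -/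
def da (t : H → ℕ) : Matching D H := M.application (M.finalRejections t)

/-- The algorithm has terminated: no further rejection, hence no further application, occurs. -/
theorem daStep_finalRejections (t : H → ℕ) :
    M.daStep t (M.finalRejections t) = M.finalRejections t := by
  have key : ∀ n : ℕ, M.daStep t ((M.daStep t)^[n] ∅) = (M.daStep t)^[n] ∅ ∨
      n + 1 ≤ ((M.daStep t)^[n + 1] ∅).card := by
    intro n
    induction n with
    | zero =>
      by_cases h : M.daStep t ∅ = ∅
      · exact Or.inl h
      · right
        simpa using Finset.card_pos.mpr (Finset.nonempty_iff_ne_empty.mpr h)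
    | succ n ih =>
      rcases ih with ih | ih
      · left
        rw [Function.iterate_succ_apply', ih, ih]
      · by_cases h : M.daStep t ((M.daStep t)^[n + 1] ∅) = (M.daStep t)^[n + 1] ∅
        · exact Or.inl h
        · right
          have hss : (M.daStep t)^[n + 1] ∅ ⊂ M.daStep t ((M.daStep t)^[n + 1] ∅) :=
            Finset.ssubset_iff_subset_ne.mpr ⟨Finset.subset_union_left, fun e => h e.symm⟩
          have := Finset.card_lt_card hss
          rw [← Function.iterate_succ_apply' (M.daStep t) (n + 1)] at this
          simp only [Nat.succ_eq_add_one] at this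
          omega
  rcases key (Fintype.card D * Fintype.card H) with h | h
  · exact h
  · have h2 := Finset.card_le_univ ((M.daStep t)^[Fintype.card D * Fintype.card H + 1] ∅)
    rw [Fintype.card_prod] at h2
    omega

end Market

end

end RegionalMatching

/-! Why the theorem is true.  For any capacities `t`, deferred acceptance yields a matching that is
stable with respect to `t` (`da_stableAt`), and every doctor weakly prefers it to any matching that
is stable for smaller or equal capacities (`da_weakly_better`).  So enlarging the target capacities
helps all doctors, and a matching `μ` that is stable for `t` remains so for the capacities
`h ↦ |μ_h|`, whose deferred acceptance outcome is `μ` again if `μ = DA(t)`.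

Among the outcomes `DA(s)` of allocations `s` that all doctors weakly prefer to `DA(t)`, take a
maximal one `μ` for the doctors' Pareto order.  The target capacities `h ↦ |μ_h|` are adapted to it.
If `μ` were not stable with respect to some allocation `s ≥ |μ_·|`, then `DA(s)` would be weakly
better than `μ` for all doctors and different from `μ`, contrary to maximality
(`StableAt.of_maximal`).  This one principle gives both remaining properties.

* Weak stability: if `(d, h)` blocks `μ`, then `h` prefers all of `μ_h` to `d`, because `μ` is stable
  with respect to the target capacities; so `h` has a vacancy.  If the region of `h` also had room,
  then `s = |μ_·| + 1_h` would be an allocation, and `(d, h)` blocks `μ` with respect to it.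
* Constrained efficiency: suppose that a feasible `μ'` Pareto dominates `μ`.  By stability of `μ`, a
  doctor who is new at `h` in `μ'` is ranked by `h` below all of `μ_h`.  By responsiveness
  (`weak_of_newcomers_worse`), a hospital whose set of doctors changes without making it worse off
  must then be given strictly more doctors, some newcomer being acceptable.  Hence `s = |μ'_·|` is
  an allocation with `s ≥ |μ_·|`, and this newcomer blocks `μ` with respect to `s`. -/

namespace RegionalMatching

open scoped Classical

/-! ### Strict preferences -/

section StrictPreference

variable {α : Type*} {P : α → α → Prop} [IsStrictTotalOrder α P]

theorem Weak.trans {a b c : α} (hab : Weak P a b) (hbc : Weak P b c) : Weak P a c := by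
  rcases hab with hab | rfl
  · rcases hbc with hbc | rfl
    · exact Or.inl (_root_.trans_of P hab hbc)
    · exact Or.inl hab
  · exact hbc

theorem Weak.not_lt {a b : α} (hab : Weak P a b) : ¬ P b a := by
  rcases hab with hab | rfl
  · exact fun h => irrefl_of P a (_root_.trans_of P hab h)
  · exact irrefl_of P a

theorem Weak.antisymm {a b : α} (hab : Weak P a b) (hba : Weak P b a) : a = b := by
  rcases hab with hab | rfl
  · exact absurd hab hba.not_lt
  · rfl

theorem weak_of_not_lt {a b : α} (h : ¬ P b a) : Weak P a b := by
  rcases trichotomous_of P a b with hab | hab | hab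
  · exact Or.inl hab
  · exact Or.inr hab
  · exact absurd hab h

/-- A nonempty finite set has a best element. -/
theorem exists_best {A : Finset α} (hA : A.Nonempty) : ∃ a ∈ A, ∀ b ∈ A, Weak P a b := by
  induction hA using Finset.Nonempty.cons_induction with
  | singleton a => exact ⟨a, by simp, fun b hb => Or.inr (Finset.mem_singleton.mp hb).symm⟩
  | cons a s has hs ih =>
    obtain ⟨m, hm, hbest⟩ := ih
    by_cases h : P a m
    · refine ⟨a, by simp, fun b hb => ?_⟩
      rcases Finset.mem_cons.mp hb with rfl | hb
      · exact Or.inr rfl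
      · exact Weak.trans (Or.inl h) (hbest b hb)
    · refine ⟨m, Finset.mem_cons_of_mem hm, fun b hb => ?_⟩
      rcases Finset.mem_cons.mp hb with rfl | hb
      · exact weak_of_not_lt h
      · exact hbest b hb

/-- If at least `n` elements of `A` are better than `d`, then so are at least `n` of the elements
of `A` that have fewer than `n` elements of `A` above them. -/
theorem le_card_top {A : Finset α} {n : ℕ} {d : α} (h : n ≤ (A.filter fun a => P a d).card) :
    n ≤ (A.filter fun a => P a d ∧ (A.filter fun b => P b a).card < n).card := by
  by_contra! hlt
  have hne : (A.filter fun a => P a d ∧ ¬ (A.filter fun b => P b a).card < n).Nonempty := by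
    by_contra hempty
    rw [Finset.not_nonempty_iff_eq_empty, Finset.filter_eq_empty_iff] at hempty
    refine absurd hlt (not_lt.mpr (h.trans (Finset.card_le_card fun a ha => ?_)))
    have := Finset.mem_filter.mp ha
    have h2 := hempty this.1
    simp only [Finset.mem_filter]
    tauto
  -- The best element outside the top `n` has only elements of the top `n` above it.
  obtain ⟨a, ha, hbest⟩ := exists_best (P := P) hne
  obtain ⟨haA, had, harank⟩ := Finset.mem_filter.mp ha
  refine harank (lt_of_le_of_lt (Finset.card_le_card fun b hb => ?_) hlt)
  obtain ⟨hbA, hba⟩ := Finset.mem_filter.mp hb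
  refine Finset.mem_filter.mpr ⟨hbA, _root_.trans_of P hba had, ?_⟩
  by_contra hb2
  exact (hbest b (Finset.mem_filter.mpr ⟨hbA, _root_.trans_of P hba had, hb2⟩)).not_lt hba

/-- If every element of `A` has fewer than `n` elements of `A` above it, then `A` has at most `n`
elements. -/
theorem card_le_of_rank_lt {A : Finset α} {n : ℕ}
    (h : ∀ a ∈ A, (A.filter fun b => P b a).card < n) : A.card ≤ n := by
  rcases A.eq_empty_or_nonempty with rfl | hA
  · simp
  · obtain ⟨w, hw, hworst⟩ := exists_best (P := Function.swap P) hA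
    have hsub : A.erase w ⊆ A.filter fun b => P b w := fun b hb => by
      obtain ⟨hbw, hbA⟩ := Finset.mem_erase.mp hb
      rcases hworst b hbA with hlt | rfl
      · exact Finset.mem_filter.mpr ⟨hbA, hlt⟩
      · exact absurd rfl hbw
    have h1 := Finset.card_le_card hsub
    rw [Finset.card_erase_of_mem hw] at h1
    have h2 := h w hw
    omega

end StrictPreference

/-! ### Responsive preferences -/

/-- Exchanging a set `S` of acceptable doctors for `S'` is no improvement under responsive
preferences if each newcomer is worse than each doctor who leaves and, unless all newcomers are
unacceptable, `S'` is not larger than `S`. -/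
theorem weak_of_newcomers_worse {D : Type*} {P : Finset D → Finset D → Prop}
    [IsStrictTotalOrder (Finset D) P] {q : ℕ} (hP : Responsive P q) {S S' : Finset D}
    (hS : S.card ≤ q) (hS' : S'.card ≤ q) (hacc : ∀ d ∈ S, P {d} ∅)
    (hworse : ∀ d ∈ S' \ S, ∀ d' ∈ S \ S', P {d'} {d})
    (hcard : ∀ d ∈ S' \ S, P {d} ∅ → S'.card ≤ S.card) : Weak P S S' := by
  -- Move from `S'` to `S` by steps that do not hurt: replace or dismiss the newcomers one at a
  -- time, then take back the missing doctors of `S`.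
  induction hn : (S' \ S).card + (S \ S').card using Nat.strong_induction_on
    generalizing S' with
  | _ n ih =>
    subst hn
    rcases (S' \ S).eq_empty_or_nonempty with hempty | ⟨d, hd⟩
    · rcases (S \ S').eq_empty_or_nonempty with hempty' | ⟨d', hd'⟩
      · exact Or.inr (Finset.Subset.antisymm (Finset.sdiff_eq_empty_iff_subset.mp hempty')
          (Finset.sdiff_eq_empty_iff_subset.mp hempty))
      · have hsub := Finset.sdiff_eq_empty_iff_subset.mp hempty
        obtain ⟨hd'S, hd'S'⟩ := Finset.mem_sdiff.mp hd'
        have hsub' : insert d' S' ⊆ S := Finset.insert_subset hd'S hsub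
        have hempty2 := Finset.sdiff_eq_empty_iff_subset.mpr hsub'
        have hle := (Finset.card_le_card hsub').trans hS
        have hstep : Weak P (insert d' S') S' := by
          have := (hP.drop (insert d' S') hle d' (Finset.mem_insert_self _ _)).mpr
            (Or.inl (hacc d' hd'S))
          rwa [Finset.erase_insert hd'S'] at this
        refine Weak.trans (ih _ ?_ hle (by simp [hempty2]) (by simp [hempty2]) rfl) hstep
        rw [hempty, hempty2, Finset.card_empty, zero_add, zero_add]
        refine Finset.card_lt_card (Finset.ssubset_iff_subset_ne.mpr ⟨?_, fun e => ?_⟩)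
        · exact Finset.sdiff_subset_sdiff le_rfl (Finset.subset_insert _ _)
        · rw [← e] at hd'
          simp at hd'
    · obtain ⟨hdS', hdS⟩ := Finset.mem_sdiff.mp hd
      by_cases hdacc : P {d} ∅
      · obtain ⟨d', hd'⟩ : (S \ S').Nonempty := by
          have h1 := hcard d hd hdacc
          have h2 := Finset.card_sdiff_add_card_inter S S'
          have h3 := Finset.card_sdiff_add_card_inter S' S
          rw [Finset.inter_comm] at h3
          have h4 := Finset.card_pos.mpr ⟨d, hd⟩
          exact Finset.card_pos.mp (by omega)
        obtain ⟨hd'S, hd'S'⟩ := Finset.mem_sdiff.mp hd'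
        have hstep := (hP.swap S' hS' d' hd'S' d hdS').mpr (Or.inl (hworse d hd d' hd'))
        have hcard' : ((insert d' S').erase d).card = S'.card := by
          rw [Finset.card_erase_of_mem (Finset.mem_insert_of_mem hdS'),
            Finset.card_insert_of_notMem hd'S', Nat.add_sub_cancel]
        have hsub1 : (insert d' S').erase d \ S ⊆ (S' \ S).erase d := fun x hx => by
          simp only [Finset.mem_sdiff, Finset.mem_erase, Finset.mem_insert] at hx ⊢
          have : x ≠ d' := fun e => hx.2 (e ▸ hd'S)
          tauto
        have hsub2 : S \ (insert d' S').erase d ⊆ S \ S' := fun x hx => by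
          simp only [Finset.mem_sdiff, Finset.mem_erase, Finset.mem_insert] at hx ⊢
          have : x ≠ d := fun e => hdS (e ▸ hx.1)
          tauto
        refine Weak.trans (ih _ ?_ (hcard'.trans_le hS') ?_ ?_ rfl) hstep
        · have h1 := Finset.card_le_card hsub1
          rw [Finset.card_erase_of_mem hd] at h1
          have h2 := Finset.card_le_card hsub2
          have h3 := Finset.card_pos.mpr ⟨d, hd⟩
          omega
        · exact fun x hx y hy => hworse x (Finset.mem_of_mem_erase (hsub1 hx)) y (hsub2 hy)
        · exact fun x hx hxa =>
            hcard'.trans_le (hcard x (Finset.mem_of_mem_erase (hsub1 hx)) hxa)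
      · have hstep : Weak P (S'.erase d) S' := by
          refine weak_of_not_lt fun h => ?_
          rcases (hP.drop S' hS' d hdS').mp (Or.inl h) with h | h
          · exact hdacc h
          · simp at h
        have hle : (S'.erase d).card ≤ S'.card := Finset.card_le_card (Finset.erase_subset _ _)
        have hsub1 : S'.erase d \ S ⊆ (S' \ S).erase d := fun x hx => by
          simp only [Finset.mem_sdiff, Finset.mem_erase] at hx ⊢
          tauto
        have hsub2 : S \ S'.erase d ⊆ S \ S' := fun x hx => by
          simp only [Finset.mem_sdiff, Finset.mem_erase] at hx ⊢
          have : x ≠ d := fun e => hdS (e ▸ hx.1)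
          tauto
        refine Weak.trans (ih _ ?_ (hle.trans hS') ?_ ?_ rfl) hstep
        · have h1 := Finset.card_le_card hsub1
          rw [Finset.card_erase_of_mem hd] at h1
          have h2 := Finset.card_le_card hsub2
          have h3 := Finset.card_pos.mpr ⟨d, hd⟩
          omega
        · exact fun x hx y hy => hworse x (Finset.mem_of_mem_erase (hsub1 hx)) y (hsub2 hy)
        · exact fun x hx hxa => hle.trans (hcard x (Finset.mem_of_mem_erase (hsub1 hx)) hxa)

theorem Matching.mem_at {D H : Type*} [Fintype D] {μ : Matching D H} {h : H} {d : D} :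
    d ∈ μ.at h ↔ μ d = some h := by
  simp [Matching.at]

namespace Market

variable {D H R : Type*} [Fintype D] [Fintype H] (M : Market D H R)

instance docPref_isStrictTotalOrder (d : D) : IsStrictTotalOrder (Option H) (M.docPref d) :=
  M.docPref_strict d

instance hospPref_isStrictTotalOrder (h : H) :
    IsStrictTotalOrder (Finset D) (M.hospPref h) :=
  M.hospPref_strict h

instance prefersDoctor_isStrictTotalOrder (h : H) :
    IsStrictTotalOrder D (M.PrefersDoctor h) where
  irrefl d := irrefl_of (M.hospPref h) {d}
  trans _ _ _ := _root_.trans_of (M.hospPref h)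
  trichotomous _ _ h1 h2 := Finset.singleton_injective
    ((weak_of_not_lt (P := M.hospPref h) h2).antisymm (weak_of_not_lt h1))

/-! ### Stability of deferred acceptance -/

/-- Stability with respect to the capacities `t`, without regard to the regional caps: capacities
are respected, the matching is individually rational, and there is no blocking pair.  The blocking
condition is stated positively: a doctor who would rather be at `h` is either unacceptable to `h`,
or `h` is full with doctors whom it prefers to her. -/
structure StableAt (t : H → ℕ) (μ : Matching D H) : Prop where
  card_le : ∀ h, (μ.at h).card ≤ t h
  individuallyRational : M.IndividuallyRational μ
  not_blocked : ∀ d h, M.docPref d (some h) (μ d) → M.AcceptableDoctor h d →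
    (μ.at h).card = t h ∧ ∀ d' ∈ μ.at h, M.PrefersDoctor h d' d

variable {M}

omit [Fintype D] in
theorem application_eq_some_iff {S : Finset (D × H)} {d : D} {h : H} :
    M.application S d = some h ↔ M.IsNextChoice S d h := by
  have huniq : ∀ h₁ h₂, M.IsNextChoice S d h₁ → M.IsNextChoice S d h₂ → h₁ = h₂ :=
    fun h₁ h₂ H₁ H₂ => Option.some_injective _ ((H₁.2.2 h₂ H₂.1).antisymm (H₂.2.2 h₁ H₁.1))
  unfold application
  split_ifs with hex
  · rw [Option.some_inj]
    exact ⟨fun e => e ▸ hex.choose_spec, huniq _ _ hex.choose_spec⟩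
  · simpa using fun hn => hex ⟨h, hn⟩

omit [Fintype D] in
/-- A doctor applies to the best hospital that has not rejected her, or stays unmatched. -/
theorem weak_application {S : Finset (D × H)} {d : D} {h : H} (hS : (d, h) ∉ S) :
    Weak (M.docPref d) (M.application S d) (some h) := by
  refine weak_of_not_lt fun hlt => ?_
  rcases happ : M.application S d with _ | h'
  · rw [happ] at hlt
    obtain ⟨a, ha, hbest⟩ := exists_best (P := M.docPref d)
      (A := (Finset.univ.filter fun h' => (d, h') ∉ S).image some)
      ⟨some h, by simp [hS]⟩
    obtain ⟨k, hk, rfl⟩ := Finset.mem_image.mp ha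
    have hnext : M.IsNextChoice S d k := by
      refine ⟨(Finset.mem_filter.mp hk).2, ?_, fun h' hh' => hbest _ (by simp [hh'])⟩
      rcases hbest (some h) (by simp [hS]) with h1 | h1
      · exact _root_.trans_of (M.docPref d) h1 hlt
      · unfold AcceptableHospital
        rwa [h1]
    rw [application_eq_some_iff.mpr hnext] at happ
    cases happ
  · have := (application_eq_some_iff.mp happ).2.2 h hS
    rw [happ] at hlt
    exact this.not_lt hlt

/-- A property of rejection sets that holds at the start and is preserved by each step holds for
the rejections of the whole run. -/
theorem finalRejections_induction {t : H → ℕ} {p : Finset (D × H) → Prop} (h0 : p ∅)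
    (hstep : ∀ S, p S → p (M.daStep t S)) : p (M.finalRejections t) := by
  unfold finalRejections
  generalize Fintype.card D * Fintype.card H = n
  induction n with
  | zero => exact h0
  | succ n ih =>
    rw [Function.iterate_succ_apply']
    exact hstep _ ih

theorem mem_daStep {t : H → ℕ} {S : Finset (D × H)} {d : D} {h : H} :
    (d, h) ∈ M.daStep t S ↔ (d, h) ∈ S ∨
      (M.application S d = some h ∧ ¬ M.Keeps (t h) h ((M.application S).at h) d) := by
  simp [daStep, Matching.mem_at]

/-- A doctor whom a hospital keeps applies there again. -/
theorem application_daStep_of_keeps {t : H → ℕ} {S : Finset (D × H)} {d : D} {h : H}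
    (hk : M.Keeps (t h) h ((M.application S).at h) d) :
    M.application (M.daStep t S) d = some h := by
  obtain ⟨hS, hacc, hbest⟩ := application_eq_some_iff.mp (Matching.mem_at.mp hk.1)
  refine application_eq_some_iff.mpr ⟨fun hmem => ?_, hacc, fun h' hh' => hbest h' fun hmem => ?_⟩
  · rcases mem_daStep.mp hmem with h1 | h1
    · exact hS h1
    · exact h1.2 hk
  · exact hh' (mem_daStep.mpr (Or.inl hmem))

/-- Throughout the algorithm, a hospital that has rejected an acceptable doctor has applicants
enough, all better than her, to fill its capacity. -/
theorem le_card_better_of_mem_finalRejections {t : H → ℕ} {d : D} {h : H}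
    (hmem : (d, h) ∈ M.finalRejections t) (hacc : M.AcceptableDoctor h d) :
    t h ≤ (((M.da t).at h).filter fun d' => M.PrefersDoctor h d' d).card := by
  suffices ∀ d h, (d, h) ∈ M.finalRejections t → M.AcceptableDoctor h d →
      t h ≤ (((M.application (M.finalRejections t)).at h).filter
        fun d' => M.PrefersDoctor h d' d).card from this d h hmem hacc
  refine finalRejections_induction (p := fun S => ∀ d h, (d, h) ∈ S → M.AcceptableDoctor h d →
      t h ≤ (((M.application S).at h).filter fun d' => M.PrefersDoctor h d' d).card) (by simp) ?_
  intro S hS d h hmem hacc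
  have hbefore : t h ≤
      (((M.application S).at h).filter fun d' => M.PrefersDoctor h d' d).card := by
    rcases mem_daStep.mp hmem with hold | ⟨happ, hnot⟩
    · exact hS d h hold hacc
    · by_contra! hlt
      exact hnot ⟨Matching.mem_at.mpr happ, hacc, hlt⟩
  -- The best `t h` applicants are kept, and therefore apply to `h` in the next step as well.
  refine (le_card_top hbefore).trans (Finset.card_le_card fun d' hd' => ?_)
  obtain ⟨happ, hbetter, hrank⟩ := Finset.mem_filter.mp hd'
  refine Finset.mem_filter.mpr ⟨Matching.mem_at.mpr (application_daStep_of_keeps ?_), hbetter⟩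
  exact ⟨happ, _root_.trans_of (M.hospPref h) hbetter hacc, hrank⟩

theorem keeps_da {t : H → ℕ} {d : D} {h : H} (hd : M.da t d = some h) :
    M.Keeps (t h) h ((M.da t).at h) d := by
  by_contra hnot
  refine (application_eq_some_iff.mp hd).1 ?_
  rw [← M.daStep_finalRejections t]
  exact mem_daStep.mpr (Or.inr ⟨hd, hnot⟩)

variable (M) in
theorem da_stableAt (t : H → ℕ) : M.StableAt t (M.da t) := by
  have hcard : ∀ h, ((M.da t).at h).card ≤ t h := fun h =>
    card_le_of_rank_lt (P := M.PrefersDoctor h) fun d hd => (keeps_da (Matching.mem_at.mp hd)).2.2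
  refine ⟨hcard, fun d h hd => ⟨(application_eq_some_iff.mp hd).2.1, (keeps_da hd).2.1⟩, ?_⟩
  intro d h hpref hacc
  have hrej : (d, h) ∈ M.finalRejections t := by
    by_contra hnot
    exact (weak_application hnot).not_lt hpref
  have hle := le_card_better_of_mem_finalRejections hrej hacc
  have hsub := Finset.filter_subset (fun d' => M.PrefersDoctor h d' d) ((M.da t).at h)
  have heq := Finset.eq_of_subset_of_card_le hsub ((hcard h).trans hle)
  refine ⟨le_antisymm (hcard h) (hle.trans (Finset.card_le_card hsub)), fun d' hd' => ?_⟩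
  rw [← heq] at hd'
  exact (Finset.mem_filter.mp hd').2

/-! ### Doctor optimality and comparative statics -/

/-- Doctor optimality and monotonicity in the capacities at once: every doctor weakly prefers
deferred acceptance to any matching that is stable for smaller or equal capacities. -/
theorem da_weakly_better {s t : H → ℕ} (hst : s ≤ t) {ν : Matching D H} (hν : M.StableAt s ν)
    (d : D) : Weak (M.docPref d) (M.da t d) (ν d) := by
  -- No doctor is ever rejected by her partner in `ν`.
  have key : ∀ d h, ν d = some h → (d, h) ∉ M.finalRejections t := by
    refine finalRejections_induction
      (p := fun S => ∀ d h, ν d = some h → (d, h) ∉ S) (by simp) ?_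
    intro S hS d h hd hmem
    rcases mem_daStep.mp hmem with hold | ⟨happ, hnot⟩
    · exact hS d h hd hold
    have hacc : M.AcceptableDoctor h d := (hν.individuallyRational d h hd).2
    have hdat : d ∈ ν.at h := Matching.mem_at.mpr hd
    -- A first such rejection requires more competitors at `h` than `ν` places there; one of them,
    -- who has not been rejected by her own partner in `ν`, blocks `ν` together with `h`.
    obtain ⟨d', hd', hd'ν⟩ : ∃ d' ∈ ((M.application S).at h).filter
        (fun d' => M.PrefersDoctor h d' d), d' ∉ (ν.at h).erase d := by
      refine Finset.exists_mem_notMem_of_card_lt_card ?_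
      rw [Finset.card_erase_of_mem hdat]
      have h1 : t h ≤
          (((M.application S).at h).filter fun d' => M.PrefersDoctor h d' d).card := by
        by_contra! hlt
        exact hnot ⟨Matching.mem_at.mpr happ, hacc, hlt⟩
      have h2 := hν.card_le h
      have h3 : s h ≤ t h := hst h
      have h4 := Finset.card_pos.mpr ⟨d, hdat⟩
      omega
    obtain ⟨happ', hbetter⟩ := Finset.mem_filter.mp hd'
    have hne : d' ≠ d := fun e => irrefl_of (M.PrefersDoctor h) d (e ▸ hbetter)
    have hνd' : ν d' ≠ some h := fun e =>
      hd'ν (Finset.mem_erase.mpr ⟨hne, Matching.mem_at.mpr e⟩)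
    have hnext := application_eq_some_iff.mp (Matching.mem_at.mp happ')
    have hpref : M.docPref d' (some h) (ν d') := by
      rcases e : ν d' with _ | k
      · exact hnext.2.1
      · rcases hnext.2.2 k (hS d' k e) with h1 | h1
        · exact h1
        · exact absurd (e.trans h1.symm) hνd'
    have hworse := (hν.not_blocked d' h hpref
      (_root_.trans_of (M.hospPref h) hbetter hacc)).2 d hdat
    exact Weak.not_lt (P := M.PrefersDoctor h) (Or.inl hbetter) hworse
  rcases e : ν d with _ | h
  · rcases e' : M.da t d with _ | k
    · exact Or.inr rfl
    · exact Or.inl (application_eq_some_iff.mp e').2.1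
  · exact weak_application (key d h e)

omit [Fintype H] in
/-- A stable matching remains stable when the vacant positions are removed. -/
theorem StableAt.card {t : H → ℕ} {μ : Matching D H} (hμ : M.StableAt t μ) :
    M.StableAt (fun h => (μ.at h).card) μ :=
  ⟨fun _ => le_rfl, hμ.individuallyRational, fun d h hp ha => ⟨rfl, (hμ.not_blocked d h hp ha).2⟩⟩

theorem da_card_da (t : H → ℕ) : M.da (fun h => ((M.da t).at h).card) = M.da t := by
  have hst := M.da_stableAt t
  funext d
  exact (da_weakly_better le_rfl hst.card d).antisymm
    (da_weakly_better hst.card_le (M.da_stableAt _) d)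

/-! ### Doctor-maximal outcomes -/

variable (M) in
/-- No allocation of the regional caps yields a deferred acceptance outcome, other than `μ`, that
all doctors weakly prefer to `μ`. -/
def DoctorMaximal (μ : Matching D H) : Prop :=
  ∀ s, M.IsAllocation s → (∀ d, Weak (M.docPref d) (M.da s d) (μ d)) → M.da s = μ

theorem exists_doctorMaximal {t : H → ℕ} (ht : M.IsAllocation t) :
    ∃ s, M.IsAllocation s ∧ M.DoctorMaximal (M.da s) ∧
      ∀ d, Weak (M.docPref d) (M.da s d) (M.da t d) := by
  let better : Matching D H → Matching D H → Prop := fun ν μ =>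
    (∀ d, Weak (M.docPref d) (ν d) (μ d)) ∧ ν ≠ μ
  have : IsTrans (Matching D H) better := ⟨fun a b c hab hbc =>
    ⟨fun d => (hab.1 d).trans (hbc.1 d), fun e => hab.2 (funext fun d =>
      (hab.1 d).antisymm (e ▸ hbc.1 d))⟩⟩
  have : Std.Irrefl better := ⟨fun a h => h.2 rfl⟩
  have hwf : WellFounded better := Finite.wellFounded_of_trans_of_irrefl better
  obtain ⟨μ, ⟨s, hs, rfl, hst⟩, hmin⟩ := hwf.has_min
    {μ | ∃ s, M.IsAllocation s ∧ M.da s = μ ∧ ∀ d, Weak (M.docPref d) (M.da s d) (M.da t d)}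
    ⟨M.da t, t, ht, rfl, fun _ => Or.inr rfl⟩
  refine ⟨s, hs, fun s' hs' hbetter => ?_, hst⟩
  by_contra hne
  exact hmin (M.da s') ⟨s', hs', rfl, fun d => (hbetter d).trans (hst d)⟩ ⟨hbetter, hne⟩

/-- A doctor-maximal stable matching is stable even with respect to every allocation that offers
at least as many positions everywhere as the matching fills. -/
theorem StableAt.of_maximal {t s : H → ℕ} {μ : Matching D H} (hμ : M.StableAt t μ)
    (hmax : M.DoctorMaximal μ) (hs : M.IsAllocation s) (hle : ∀ h, (μ.at h).card ≤ s h) :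
    M.StableAt s μ := by
  have h := M.da_stableAt s
  rwa [hmax s hs (da_weakly_better hle hμ.card)] at h

theorem StableAt.feasible {t : H → ℕ} {μ : Matching D H} (hμ : M.StableAt t μ)
    (ht : M.IsAllocation t) : M.Feasible μ :=
  ⟨fun r => (Finset.sum_le_sum fun h _ => hμ.card_le h).trans (ht.2 r),
    fun h => (hμ.card_le h).trans (ht.1 h)⟩

theorem Feasible.isAllocation {μ : Matching D H} (hμ : M.Feasible μ) :
    M.IsAllocation fun h => (μ.at h).card :=
  ⟨hμ.2, hμ.1⟩

theorem StableAt.weaklyStable {t : H → ℕ} {μ : Matching D H} (hμ : M.StableAt t μ)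
    (ht : M.IsAllocation t) (hmax : M.DoctorMaximal μ) : M.WeaklyStable μ := by
  have hfeas := hμ.feasible ht
  refine ⟨hfeas, hμ.individuallyRational, fun d h ⟨hpref, hblock⟩ => ?_⟩
  have hacc : M.AcceptableDoctor h d := by
    rcases hblock with hblock | ⟨d', hd', hbetter⟩
    · exact hblock.2
    · exact _root_.trans_of (M.hospPref h) hbetter
        (hμ.individuallyRational d' h (Matching.mem_at.mp hd')).2
  have hworse := (hμ.not_blocked d h hpref hacc).2
  refine ⟨?_, hworse⟩
  have hroom : (μ.at h).card < M.cap h := by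
    rcases hblock with hblock | ⟨d', hd', hbetter⟩
    · exact hblock.1
    · exact absurd (hworse d' hd') (Weak.not_lt (P := M.PrefersDoctor h) (Or.inl hbetter))
  by_contra hne
  have hslack := lt_of_le_of_ne (hfeas.1 (M.region h)) hne
  -- There is room for one more position at `h`.
  have hs : M.IsAllocation fun k => (μ.at k).card + if k = h then 1 else 0 := by
    refine ⟨fun k => ?_, fun r => ?_⟩
    · by_cases hk : k = h
      · subst hk
        simpa using hroom
      · simpa [hk] using hfeas.2 k
    · rw [Finset.sum_add_distrib, Finset.sum_ite_eq']
      have h1 := hfeas.1 r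
      unfold regionLoad at h1 hslack
      split_ifs with hmem
      · have hr : M.region h = r := by simpa [hospitalsIn] using hmem
        subst hr
        exact hslack
      · simpa using h1
  have := ((hμ.of_maximal hmax hs fun k => Nat.le_add_right _ _).not_blocked d h hpref hacc).1
  simp at this

omit [Fintype H] in
/-- A hospital that does not lose by a reassignment under which all doctors it gains move there
voluntarily, away from a stable matching, either keeps the same doctors or gets strictly more of
them, an acceptable newcomer included. -/
theorem StableAt.eq_or_card_lt {t : H → ℕ} {μ μ' : Matching D H} (hμ : M.StableAt t μ)
    (hdoc : ∀ d, Weak (M.docPref d) (μ' d) (μ d)) {h : H} (hcap : (μ.at h).card ≤ M.cap h)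
    (hcap' : (μ'.at h).card ≤ M.cap h) (hhosp : Weak (M.hospPref h) (μ'.at h) (μ.at h)) :
    μ'.at h = μ.at h ∨ (μ.at h).card < (μ'.at h).card ∧
      ∃ d, M.docPref d (some h) (μ d) ∧ M.AcceptableDoctor h d := by
  have hnew : ∀ d ∈ μ'.at h \ μ.at h, M.docPref d (some h) (μ d) := fun d hd => by
    simp only [Finset.mem_sdiff, Matching.mem_at] at hd
    rcases hdoc d with h1 | h1
    · rwa [hd.1] at h1
    · exact absurd (h1 ▸ hd.1) hd.2
  by_cases hex : ∃ d ∈ μ'.at h \ μ.at h, M.AcceptableDoctor h d ∧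
      (μ.at h).card < (μ'.at h).card
  · obtain ⟨d, hd, hacc, hlt⟩ := hex
    exact Or.inr ⟨hlt, d, hnew d hd, hacc⟩
  · push Not at hex
    refine Or.inl (hhosp.antisymm
      (weak_of_newcomers_worse (M.responsive h) hcap hcap' ?_ ?_ hex))
    · exact fun d hd => (hμ.individuallyRational d h (Matching.mem_at.mp hd)).2
    · intro d hd d' hd'
      have hd'at := (Finset.mem_sdiff.mp hd').1
      have hacc' := (hμ.individuallyRational d' h (Matching.mem_at.mp hd'at)).2
      by_cases hacc : M.AcceptableDoctor h d
      · exact (hμ.not_blocked d h (hnew d hd) hacc).2 d' hd'at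
      · -- An acceptable doctor is better than an unacceptable one.
        rcases weak_of_not_lt (P := M.hospPref h) hacc with h1 | h1
        · exact _root_.trans_of (M.hospPref h) hacc' h1
        · rwa [← h1]

theorem StableAt.constrainedEfficient {t : H → ℕ} {μ : Matching D H} (hμ : M.StableAt t μ)
    (ht : M.IsAllocation t) (hmax : M.DoctorMaximal μ) : M.ConstrainedEfficient μ := by
  have hfeas := hμ.feasible ht
  refine ⟨hfeas, fun ⟨μ', hfeas', hdoc, hhosp, hstrict⟩ => ?_⟩
  have hcases := fun h => hμ.eq_or_card_lt hdoc (hfeas.2 h) (hfeas'.2 h) (hhosp h)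
  have hle : ∀ h, (μ.at h).card ≤ (μ'.at h).card := fun h => by
    rcases hcases h with h1 | h1
    · rw [h1]
    · exact h1.1.le
  have hstable := hμ.of_maximal hmax hfeas'.isAllocation hle
  -- Stability with respect to the larger capacities rules out any change at the hospitals.
  have hat : ∀ h, μ'.at h = μ.at h := fun h => by
    rcases hcases h with h1 | ⟨hlt, d, hpref, hacc⟩
    · exact h1
    · exact absurd (hstable.not_blocked d h hpref hacc).1 hlt.ne
  rcases hstrict with ⟨d, hd⟩ | ⟨h, hh⟩
  · refine irrefl_of (M.docPref d) (μ d) ?_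
    have : μ' d = μ d := Option.ext fun h => by
      rw [← Matching.mem_at, ← Matching.mem_at, hat h]
    rwa [this] at hd
  · rw [hat h] at hh
    exact irrefl_of (M.hospPref h) _ hh

end Market

end RegionalMatching

theorem theorem1 {D H R : Type*} [Fintype D] [Fintype H] [Fintype R]
    (M : RegionalMatching.Market D H R) (t : H → ℕ) (ht : M.IsAllocation t)
    (hineff : ¬ M.ConstrainedEfficient (M.da t)) :
    ∃ t' : H → ℕ, M.IsAllocation t' ∧
      (∀ h, ((M.da t').at h).card = t' h) ∧
      M.ConstrainedEfficient (M.da t') ∧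
      M.WeaklyStable (M.da t') ∧
      ∀ d, RegionalMatching.Weak (M.docPref d) (M.da t' d) (M.da t d) := by
  obtain ⟨s, hs, hmax, hbetter⟩ := RegionalMatching.Market.exists_doctorMaximal ht
  have hst := M.da_stableAt s
  refine ⟨fun h => ((M.da s).at h).card, (hst.feasible hs).isAllocation, ?_⟩
  rw [RegionalMatching.Market.da_card_da]
  exact ⟨fun _ => rfl, hst.constrainedEfficient hs hmax, hst.weaklyStable hs hmax, hbetter⟩
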